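/- Let $n\ge 1$ and $\lambda_s,\lambda_e>0$. A source updates itself at the points of a Poisson process of rate $\lambda_e$; the time between two consecutive self-updates is a cycle (the first cycle starts at time $0$). At the start of every cycle all $n$ nodes are stale. During a cycle the source sends its current version to the nodes, and the nodes do not communicate with each other (a disconnected network). The update rates are rate-changing: while exactly $k<n$ nodes are fresh, each of the $n-k$ stale nodes is updated by the source after an exponential time of rate $\lambda_s/(n-k)$ (the clocks of the stale nodes being independent of each other, of the past and of the self-updates of the source, and restarting with the new rate as soon as a further node becomes fresh), and fresh nodes are not updated. A node keeps the latest version it has received. Let $\nu_s(t)$ and $\nu_i(t)$ be the versions held at time $t$ by the source and by node $i$, let $F_i(t)=\mathbb{1}\{\nu_i(t)=\nu_s(t)\}$ be the binary freshness of node $i$, and let $$\overline F_i=\limsup_{T\to\infty}\frac1T\,\mathbb{E}\left[\int_0^T F_i(t)\,dt\right]$$ be its long-term average freshness. Then $F_i$ is integrable on $\Omega\times(0,T]$ for every $T>0$ (where $\Omega$ is the underlying probability space), and for every node $i\in\{1,\dots,n\}$ $$\overline F_i=\frac{\lambda_s}{n\lambda_e}\left[1-\left(\frac{\lambda_s}{\lambda_s+\lambda_e}\right)^n\right].$$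 -/

import Mathlib

open MeasureTheory ProbabilityTheory Filter

noncomputable section

namespace RCGossip

/-- The random clocks that drive a disconnected network of `n` nodes under rate-changing gossip.

* `selfGap j` is the time between the `j`-th and the `(j+1)`-st self-update of the source: these
  gaps are i.i.d. exponential of rate `lamE`, so the self-updates form a Poisson process of
  rate `lamE`. The time between two consecutive self-updates is called a cycle.
* `clock j k i` is the time that the source would need, in cycle `j`, to update node `i`, counted
  from the moment at which exactly `k` nodes became fresh; it is exponential
  of rate `lamS / (n - k)`, the rate at which each stale node is updated while `k` nodes are fresh.

All these clocks are mutually independent. -/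
structure Clocks (n : ℕ) (lamS lamE : ℝ) {Ω : Type*} [MeasurableSpace Ω] (P : Measure Ω) where
  selfGap : ℕ → Ω → ℝ
  clock : ℕ → Fin n → Fin n → Ω → ℝ
  measurable_selfGap : ∀ j, Measurable (selfGap j)
  measurable_clock : ∀ j k i, Measurable (clock j k i)
  law_selfGap : ∀ j, P.map (selfGap j) = expMeasure lamE
  law_clock : ∀ j (k : Fin n) i,
    P.map (clock j k i) = expMeasure (lamS / ((n : ℝ) - ((k : ℕ) : ℝ)))
  indep : iIndepFun
    (Sum.elim selfGap (fun a : ℕ × Fin n × Fin n => clock a.1 a.2.1 a.2.2)) P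

section Cycle

variable {n : ℕ}

open Classical in
/-- The set of fresh nodes after `k` deliveries in a cycle with clocks `c`. A cycle starts with all
nodes stale; when `k` deliveries have been made, the next one goes to the stale node whose
clock `c k i` rings first (ties have probability zero). -/
def freshAfter (c : Fin n → Fin n → ℝ) : ℕ → Finset (Fin n)
  | 0 => ∅
  | k + 1 =>
    if h : k < n then
      freshAfter c k ∪ Finset.univ.filter (fun i => i ∉ freshAfter c k ∧
        ∀ i', i' ∉ freshAfter c k → c ⟨k, h⟩ i ≤ c ⟨k, h⟩ i')
    else freshAfter c k

/-- The time, counted from the start of the cycle, of the `k`-th delivery in a cycle with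
clocks `c`: the gap between deliveries `k` and `k + 1` is the smallest clock `c k i` over the nodes
`i` that are still stale. -/
def deliveryTime (c : Fin n → Fin n → ℝ) : ℕ → ℝ
  | 0 => 0
  | k + 1 =>
    deliveryTime c k +
      (if h : k < n then ⨅ i : {i : Fin n // i ∉ freshAfter c k}, c ⟨k, h⟩ i.1 else 0)

end Cycle

namespace Clocks

variable {n : ℕ} {lamS lamE : ℝ} {Ω : Type*} [MeasurableSpace Ω] {P : Measure Ω}

/-- The starting time of cycle `j`: cycle `0` starts at time `0`, and cycle `j + 1` starts with the
`(j+1)`-st self-update of the source. -/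
def cycleStart (N : Clocks n lamS lamE P) (j : ℕ) (ω : Ω) : ℝ :=
  ∑ l ∈ Finset.range j, N.selfGap l ω

/-- The version `ν_s(t)` of the source: it holds version `1` at time `0`, and each self-update
increases the version by one. -/
def sourceVersion (N : Clocks n lamS lamE P) (t : ℝ) (ω : Ω) : ℕ :=
  1 + {j : ℕ | N.cycleStart (j + 1) ω ≤ t}.ncard

/-- Node `i` has received, by time `t`, the version that the source holds during cycle `j`
(that is, version `j + 1`): some delivery, made before the cycle ended, went to node `i`. -/
def Received (N : Clocks n lamS lamE P) (i : Fin n) (j : ℕ) (t : ℝ) (ω : Ω) : Prop :=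
  ∃ k : ℕ, k < n ∧
    i ∈ freshAfter (fun k i => N.clock j k i ω) (k + 1) ∧
    N.cycleStart j ω + deliveryTime (fun k i => N.clock j k i ω) (k + 1) ≤ t ∧
    N.cycleStart j ω + deliveryTime (fun k i => N.clock j k i ω) (k + 1) < N.cycleStart (j + 1) ω

/-- The version `ν_i(t)` of node `i`: the latest version that it has received by time `t`, and `0`
if it has received none. -/
def nodeVersion (N : Clocks n lamS lamE P) (i : Fin n) (t : ℝ) (ω : Ω) : ℕ :=
  sSup {v : ℕ | ∃ j : ℕ, v = j + 1 ∧ N.Received i j t ω}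

/-- The binary freshness `F_i(t)` of node `i` at time `t`. -/
def freshness (N : Clocks n lamS lamE P) (i : Fin n) (t : ℝ) (ω : Ω) : ℝ :=
  if N.nodeVersion i t ω = N.sourceVersion t ω then 1 else 0

/-- The long-term average freshness of node `i`,
`limsup_{T → ∞} (1 / T) E[∫_0^T F_i(t) dt]`. -/
def averageFreshness (N : Clocks n lamS lamE P) (i : Fin n) : ℝ :=
  limsup (fun T : ℝ => (1 / T) * ∫ ω, (∫ t in (0 : ℝ)..T, N.freshness i t ω) ∂P) atTop

end Clocks

end RCGossip

end

noncomputable section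

namespace RCGossip

open scoped ENNReal Topology

/-! Let `D` be the time a node needs, from the start of a cycle, to become fresh if the cycle is
never cut short. The node is fresh at time `t` exactly when the cycle containing `t` began by time
`t - D`, that is, when `D ≤ t` and the source makes no self-update in `(t - D, t]`. Since `D` is
independent of the self-updates, the memoryless property gives this event the probability `E[exp
(-lamE * D); D ≤ t]` (`tsum_prob_cycle_covers`, `prob_freshSet`). It tends to `E[exp (-lamE * D)]`,
so the time averages have the same limit and the limsup is that limit.

The Laplace transform comes from competing clocks (`lintegral_pi_expMeasure_argmin`). With `k` fresh
nodes, the minimum of `n - k` clocks of rate `lamS / (n - k)` has rate `lamS` whatever `k` is, and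
is independent of which stale node wins, all being equally likely (`deliveryLaplace_becomesFresh`).
So `D` is a sum of `K` exponential times of rate `lamS` with `K` uniform on `1, …, n`, and a
geometric sum finishes (`lintegral_exp_freshTime`). -/

/-! ### Exponential laws, competing clocks, Cesàro means -/

lemma expMeasure_eq_withDensity (r : ℝ) :
    expMeasure r = volume.withDensity (exponentialPDF r) := rfl

lemma measurable_exponentialPDF (r : ℝ) : Measurable (exponentialPDF r) :=
  (measurable_exponentialPDFReal r).ennreal_ofReal

instance nullSingletonClass_expMeasure (r : ℝ) : NullSingletonClass (expMeasure r) := by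
  rw [expMeasure_eq_withDensity]; infer_instance

lemma expMeasure_Iic {r : ℝ} (hr : 0 < r) {x : ℝ} (hx : 0 ≤ x) :
    expMeasure r (Set.Iic x) = ENNReal.ofReal (1 - Real.exp (-(r * x))) := by
  rw [expMeasure_eq_withDensity, withDensity_apply _ measurableSet_Iic,
    lintegral_exponentialPDF_eq_antiDeriv hr, if_pos hx]

lemma expMeasure_Ioi {r : ℝ} (hr : 0 < r) {x : ℝ} (hx : 0 ≤ x) :
    expMeasure r (Set.Ioi x) = ENNReal.ofReal (Real.exp (-(r * x))) := by
  have := isProbabilityMeasure_expMeasure hr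
  rw [← Set.compl_Iic, prob_compl_eq_one_sub measurableSet_Iic, expMeasure_Iic hr hx,
    ← ENNReal.ofReal_one, ← ENNReal.ofReal_sub]
  · congr 1; ring
  · have : Real.exp (-(r * x)) ≤ 1 := Real.exp_le_one_iff.2 (by nlinarith)
    linarith

lemma expMeasure_Ici {r : ℝ} (hr : 0 < r) {x : ℝ} (hx : 0 ≤ x) :
    expMeasure r (Set.Ici x) = ENNReal.ofReal (Real.exp (-(r * x))) := by
  rw [← expMeasure_Ioi hr hx, measure_congr Ioi_ae_eq_Ici]

lemma ae_pos_expMeasure {r : ℝ} (hr : 0 < r) : ∀ᵐ x ∂expMeasure r, 0 < x := by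
  have := isProbabilityMeasure_expMeasure hr
  exact (mem_ae_iff_prob_eq_one measurableSet_Ioi).2 (by simpa using expMeasure_Ioi hr le_rfl)

/-- Exponential tilting: `exp (-a x)` times the density of rate `r` is `r / (r + a)` times the
density of rate `r + a`. -/
lemma lintegral_exp_neg_expMeasure {r a : ℝ} (hr : 0 < r) (ha : 0 ≤ a) :
    ∫⁻ x, ENNReal.ofReal (Real.exp (-(a * x))) ∂expMeasure r = ENNReal.ofReal (r / (r + a)) := by
  have hra : 0 < r + a := by linarith
  rw [expMeasure_eq_withDensity, lintegral_withDensity_eq_lintegral_mul _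
    (measurable_exponentialPDF r) (by fun_prop)]
  have h : ∀ x : ℝ, (exponentialPDF r * fun x => ENNReal.ofReal (Real.exp (-(a * x)))) x =
      ENNReal.ofReal (r / (r + a)) * exponentialPDF (r + a) x := by
    intro x
    simp only [Pi.mul_apply]
    rcases lt_or_ge x 0 with hx | hx
    · simp [exponentialPDF_of_neg hx]
    · rw [exponentialPDF_of_nonneg hx, exponentialPDF_of_nonneg hx,
        ← ENNReal.ofReal_mul (by positivity), ← ENNReal.ofReal_mul (by positivity), mul_assoc,
        ← Real.exp_add]
      congr 1
      field_simp
      ring_nf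
  simp_rw [h]
  rw [lintegral_const_mul _ (measurable_exponentialPDF _), lintegral_exponentialPDF_eq_one hra,
    mul_one]

/-- Integrating over a finite product of probability measures is unchanged if one coordinate is
resampled. -/
lemma lintegral_pi_update {ι : Type*} [Fintype ι] [DecidableEq ι] {X : ι → Type*}
    [∀ i, MeasurableSpace (X i)] (μ : ∀ i, Measure (X i)) [∀ i, IsProbabilityMeasure (μ i)]
    {f : (∀ i, X i) → ℝ≥0∞} (hf : Measurable f) (i : ι) :
    ∫⁻ x, f x ∂Measure.pi μ = ∫⁻ x, ∫⁻ u, f (Function.update x i u) ∂μ i ∂Measure.pi μ := by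
  have hm : Measurable fun x => ∫⁻ u, f (Function.update x i u) ∂μ i := by
    rw [← lmarginal_singleton]
    exact hf.lmarginal μ
  -- It suffices to compare marginals over coordinate `i`; the right side no longer depends on it,
  -- and `μ i` has mass one.
  refine lintegral_eq_of_lmarginal_eq {i} hf hm ?_
  rw [lmarginal_singleton, lmarginal_singleton]
  simp

/-- Competing exponential clocks: the Laplace transform of the minimum of the clocks in `s`, on the
event that the clock `i` rings first. -/
lemma lintegral_pi_expMeasure_argmin {ι : Type*} [Fintype ι] {ρ a : ℝ} (hρ : 0 < ρ)
    (ha : 0 ≤ a) (s : Finset ι) {i : ι} (hi : i ∈ s) :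
    ∫⁻ y, {y : ι → ℝ | ∀ j ∈ s, y i ≤ y j}.indicator
        (fun y => ENNReal.ofReal (Real.exp (-(a * y i)))) y
        ∂Measure.pi (fun _ : ι => expMeasure ρ) =
      ENNReal.ofReal (ρ / (s.card * ρ + a)) := by
  classical
  have := isProbabilityMeasure_expMeasure hρ
  have hms : MeasurableSet {y : ι → ℝ | ∀ j ∈ s, y i ≤ y j} := by
    simp only [Set.ofPred_forall]
    exact Finset.measurableSet_biInter _ fun j _ =>
      measurableSet_le (measurable_pi_apply i) (measurable_pi_apply j)
  have hf : Measurable ({y : ι → ℝ | ∀ j ∈ s, y i ≤ y j}.indicator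
      (fun y => ENNReal.ofReal (Real.exp (-(a * y i))))) :=
    Measurable.indicator (by fun_prop) hms
  -- Fix the value `u` of clock `i` first: the event then only asks the other clocks of `s` to be at
  -- least `u`, a product event. Each of these `s.card - 1` clocks contributes a factor `exp (-ρ
  -- u)`.
  rw [lintegral_pi_update _ hf i, lintegral_lintegral_swap (by
    refine (hf.comp ?_).aemeasurable
    exact measurable_update')]
  have hinner : ∀ᵐ u ∂expMeasure ρ,
      ∫⁻ y, {y : ι → ℝ | ∀ j ∈ s, y i ≤ y j}.indicator
        (fun y => ENNReal.ofReal (Real.exp (-(a * y i)))) (Function.update y i u)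
        ∂Measure.pi (fun _ : ι => expMeasure ρ) =
      ENNReal.ofReal (Real.exp (-((a + (s.card - 1) * ρ) * u))) := by
    filter_upwards [ae_pos_expMeasure hρ] with u hu
    have h1 : ∀ y : ι → ℝ, {y : ι → ℝ | ∀ j ∈ s, y i ≤ y j}.indicator
        (fun y => ENNReal.ofReal (Real.exp (-(a * y i)))) (Function.update y i u) =
        (Set.univ.pi fun j => if j ∈ s.erase i then Set.Ici u else Set.univ).indicator
          (fun _ => ENNReal.ofReal (Real.exp (-(a * u)))) y := by
      intro y
      have : Function.update y i u ∈ {y : ι → ℝ | ∀ j ∈ s, y i ≤ y j} ↔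
          y ∈ (Set.univ.pi fun j => if j ∈ s.erase i then Set.Ici u else Set.univ) := by
        simp only [Set.mem_ofPred_eq, Function.update_self, Set.mem_pi, Set.mem_univ, true_imp_iff]
        refine forall_congr' fun j => ?_
        by_cases hj : j = i
        · subst hj; simp
        · by_cases hjs : j ∈ s <;> simp [hj, hjs]
      by_cases hy : Function.update y i u ∈ {y : ι → ℝ | ∀ j ∈ s, y i ≤ y j}
      · rw [Set.indicator_of_mem hy, Set.indicator_of_mem (this.1 hy), Function.update_self]
      · rw [Set.indicator_of_notMem hy, Set.indicator_of_notMem (mt this.2 hy)]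
    simp_rw [h1]
    rw [lintegral_indicator_const (MeasurableSet.univ_pi fun j => by
      split_ifs; exacts [measurableSet_Ici, MeasurableSet.univ]), Measure.pi_pi]
    have h2 : ∀ j, expMeasure ρ (if j ∈ s.erase i then Set.Ici u else Set.univ) =
        if j ∈ s.erase i then ENNReal.ofReal (Real.exp (-(ρ * u))) else 1 := by
      intro j
      split_ifs
      · exact expMeasure_Ici hρ hu.le
      · simp
    simp_rw [h2]
    rw [Finset.prod_ite_mem, Finset.univ_inter, Finset.prod_const, Finset.card_erase_of_mem hi,
      ← ENNReal.ofReal_pow (by positivity), ← ENNReal.ofReal_mul (by positivity), ← Real.exp_nat_mul,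
      ← Real.exp_add, Nat.cast_sub (Finset.card_pos.2 ⟨i, hi⟩)]
    congr 2
    push_cast
    ring
  have hc : (1 : ℝ) ≤ s.card := by exact_mod_cast Finset.card_pos.2 ⟨i, hi⟩
  rw [lintegral_congr_ae hinner, lintegral_exp_neg_expMeasure hρ
    (add_nonneg ha (mul_nonneg (by linarith) hρ.le))]
  congr 2
  ring

/-- Continuous Cesàro means of a bounded convergent function converge to its limit. -/
lemma tendsto_average_intervalIntegral {φ : ℝ → ℝ} (hφ : Measurable φ) {C L : ℝ}
    (hC : ∀ t, |φ t| ≤ C) (hL : Tendsto φ atTop (𝓝 L)) :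
    Tendsto (fun T : ℝ => (1 / T) * ∫ t in (0 : ℝ)..T, φ t) atTop (𝓝 L) := by
  -- Substituting `t = T * u` fixes the domain, so dominated convergence applies.
  have h : Tendsto (fun T : ℝ => ∫ u in (0 : ℝ)..1, φ (T * u)) atTop
      (𝓝 (∫ _ in (0 : ℝ)..1, L)) := by
    refine intervalIntegral.tendsto_integral_filter_of_dominated_convergence (fun _ => C) ?_ ?_
      intervalIntegrable_const ?_
    · exact Eventually.of_forall fun T =>
        (hφ.comp (measurable_const_mul T)).aestronglyMeasurable
    · exact Eventually.of_forall fun T => Eventually.of_forall fun u _ => hC _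
    · refine Eventually.of_forall fun u hu => ?_
      rw [Set.uIoc_of_le zero_le_one] at hu
      exact hL.comp (tendsto_id.atTop_mul_const hu.1)
  rw [intervalIntegral.integral_const, sub_zero, one_smul] at h
  refine h.congr' ?_
  filter_upwards [eventually_gt_atTop 0] with T hT
  rw [intervalIntegral.integral_comp_mul_left _ hT.ne', mul_zero, mul_one, smul_eq_mul, one_div]

/-! ### Deliveries within one cycle -/

variable {n : ℕ}

/-- The clocks of a cycle are regular if they are positive and no two of them tie. -/
def RegularClocks (c : Fin n → Fin n → ℝ) : Prop :=
  (∀ k i, 0 < c k i) ∧ ∀ k, Function.Injective (c k)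

lemma mem_freshAfter_succ (c : Fin n → Fin n → ℝ) {k : ℕ} (hk : k < n) (i : Fin n) :
    i ∈ freshAfter c (k + 1) ↔ i ∈ freshAfter c k ∨
      (i ∉ freshAfter c k ∧ ∀ j, j ∉ freshAfter c k → c ⟨k, hk⟩ i ≤ c ⟨k, hk⟩ j) := by
  simp [freshAfter, hk]

lemma freshAfter_mono (c : Fin n → Fin n → ℝ) : Monotone (freshAfter c) := by
  refine monotone_nat_of_le_succ fun k => ?_
  by_cases hk : k < n
  · intro i hi
    exact (mem_freshAfter_succ c hk i).2 (Or.inl hi)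
  · simp [freshAfter, hk]

lemma exists_freshAfter_succ_eq_insert {c : Fin n → Fin n → ℝ} (hc : RegularClocks c) {k : ℕ}
    (hk : k < n) (hne : (freshAfter c k)ᶜ.Nonempty) :
    ∃ i ∉ freshAfter c k, freshAfter c (k + 1) = insert i (freshAfter c k) := by
  obtain ⟨i, hi, hmin⟩ := Finset.exists_min_image _ (c ⟨k, hk⟩) hne
  have hi' : i ∉ freshAfter c k := by simpa using hi
  refine ⟨i, hi', ?_⟩
  ext j
  rw [mem_freshAfter_succ c hk, Finset.mem_insert, or_comm]
  refine ⟨Or.imp_left ?_, Or.imp_left ?_⟩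
  · rintro ⟨hj, hjm⟩
    exact hc.2 ⟨k, hk⟩ (le_antisymm (hjm i hi') (hmin j (by simpa using hj)))
  · rintro rfl
    exact ⟨hi', fun j hj => hmin j (by simpa using hj)⟩

/-- In a cycle with regular clocks, the `k`-th delivery makes exactly one more node fresh. -/
lemma card_freshAfter {c : Fin n → Fin n → ℝ} (hc : RegularClocks c) {k : ℕ} (hk : k ≤ n) :
    (freshAfter c k).card = k := by
  induction k with
  | zero => simp [freshAfter]
  | succ k ih =>
    have ih := ih (Nat.le_of_succ_le hk)
    have hne : (freshAfter c k)ᶜ.Nonempty := by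
      rw [← Finset.card_pos, Finset.card_compl, ih, Fintype.card_fin]; omega
    obtain ⟨i, hi, h⟩ := exists_freshAfter_succ_eq_insert hc hk hne
    rw [h, Finset.card_insert_of_notMem hi, ih]

lemma deliveryTime_succ_of_argmin (c : Fin n → Fin n → ℝ) {k : ℕ} (hk : k < n) {i : Fin n}
    (hi : i ∉ freshAfter c k) (hmin : ∀ j, j ∉ freshAfter c k → c ⟨k, hk⟩ i ≤ c ⟨k, hk⟩ j) :
    deliveryTime c (k + 1) = deliveryTime c k + c ⟨k, hk⟩ i := by
  rw [deliveryTime, dif_pos hk]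
  congr 1
  have : Nonempty {i : Fin n // i ∉ freshAfter c k} := ⟨⟨i, hi⟩⟩
  refine le_antisymm (ciInf_le (Set.finite_range fun j : {i : Fin n // i ∉ freshAfter c k} =>
    c ⟨k, hk⟩ j.1).bddBelow ⟨i, hi⟩) ?_
  exact le_ciInf fun j => hmin j.1 j.2

lemma deliveryTime_mono {c : Fin n → Fin n → ℝ} (hc : RegularClocks c) :
    Monotone (deliveryTime c) := by
  refine monotone_nat_of_le_succ fun k => ?_
  rw [deliveryTime, le_add_iff_nonneg_right]
  split_ifs with hk
  · exact Real.iInf_nonneg fun i => (hc.1 _ _).le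
  · exact le_rfl

/-- Node `i` becomes fresh with delivery `k + 1`. -/
def BecomesFresh (i : Fin n) (k : ℕ) (c : Fin n → Fin n → ℝ) : Prop :=
  i ∉ freshAfter c k ∧ i ∈ freshAfter c (k + 1)

lemma becomesFresh_iff (i : Fin n) {k : ℕ} (hk : k < n) (c : Fin n → Fin n → ℝ) :
    BecomesFresh i k c ↔ i ∉ freshAfter c k ∧
      ∀ j, j ∉ freshAfter c k → c ⟨k, hk⟩ i ≤ c ⟨k, hk⟩ j := by
  rw [BecomesFresh, mem_freshAfter_succ c hk]
  tauto

lemma exists_becomesFresh_iff_eq {c : Fin n → Fin n → ℝ} (hc : RegularClocks c) {k : ℕ}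
    (hk : k < n) : ∃ j, ∀ l, BecomesFresh l k c ↔ l = j := by
  obtain ⟨j, hj, h⟩ := exists_freshAfter_succ_eq_insert hc hk (by
    rw [← Finset.card_pos, Finset.card_compl, card_freshAfter hc hk.le, Fintype.card_fin]; omega)
  refine ⟨j, fun l => ?_⟩
  rw [BecomesFresh, h, Finset.mem_insert]
  constructor
  · tauto
  · rintro rfl
    tauto

lemma BecomesFresh.unique {i : Fin n} {k l : ℕ} {c : Fin n → Fin n → ℝ}
    (hk : BecomesFresh i k c) (hl : BecomesFresh i l c) : k = l := by
  by_contra hne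
  rcases lt_or_gt_of_ne hne with h | h
  · exact hl.1 (freshAfter_mono c h hk.2)
  · exact hk.1 (freshAfter_mono c h hl.2)

lemma exists_becomesFresh_le (i : Fin n) (c : Fin n → Fin n → ℝ) {k : ℕ}
    (h : i ∈ freshAfter c (k + 1)) : ∃ l ≤ k, BecomesFresh i l c := by
  induction k with
  | zero => exact ⟨0, le_rfl, by simp [freshAfter], h⟩
  | succ k ih =>
    by_cases hi : i ∈ freshAfter c (k + 1)
    · obtain ⟨l, hl, hb⟩ := ih hi
      exact ⟨l, by omega, hb⟩
    · exact ⟨k + 1, le_rfl, hi, h⟩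

lemma exists_becomesFresh (i : Fin n) {c : Fin n → Fin n → ℝ} (hc : RegularClocks c) :
    ∃ k < n, BecomesFresh i k c := by
  have hn : 0 < n := i.pos
  have huniv : freshAfter c n = Finset.univ := by
    rw [← Finset.card_eq_iff_eq_univ, card_freshAfter hc le_rfl, Fintype.card_fin]
  obtain ⟨l, hl, hb⟩ := exists_becomesFresh_le i c (k := n - 1)
    (by rw [Nat.sub_add_cancel hn, huniv]; exact Finset.mem_univ _)
  exact ⟨l, by omega, hb⟩

open Classical in
/-- The time, counted from the start of the cycle, at which node `i` becomes fresh. -/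
def freshTime (i : Fin n) (c : Fin n → Fin n → ℝ) : ℝ :=
  ∑ k ∈ Finset.range n, if BecomesFresh i k c then deliveryTime c (k + 1) else 0

/-- By `BecomesFresh.unique` at most one term of the defining sum survives; writing it as a sum
makes measurability immediate. -/
lemma freshTime_eq {i : Fin n} {k : ℕ} (hk : k < n) {c : Fin n → Fin n → ℝ}
    (h : BecomesFresh i k c) : freshTime i c = deliveryTime c (k + 1) := by
  classical
  rw [freshTime, Finset.sum_eq_single_of_mem k (Finset.mem_range.2 hk), if_pos h]
  intro l _ hl
  rw [if_neg fun h' => hl (h'.unique h)]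

lemma freshTime_nonneg (i : Fin n) {c : Fin n → Fin n → ℝ} (hc : RegularClocks c) :
    0 ≤ freshTime i c := by
  obtain ⟨k, hk, hb⟩ := exists_becomesFresh i hc
  rw [freshTime_eq hk hb]
  exact deliveryTime_mono hc (Nat.zero_le _)

/-- Delivery times do not decrease, so for a downward closed `P` the best witness is the delivery
that reaches `i`. Hence it is harmless that `Received` admits later deliveries too. -/
lemma exists_delivery_iff (i : Fin n) {c : Fin n → Fin n → ℝ} (hc : RegularClocks c)
    {P : ℝ → Prop} (hP : ∀ x y, x ≤ y → P y → P x) :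
    (∃ k < n, i ∈ freshAfter c (k + 1) ∧ P (deliveryTime c (k + 1))) ↔ P (freshTime i c) := by
  constructor
  · rintro ⟨k, hk, hi, hp⟩
    obtain ⟨l, hl, hb⟩ := exists_becomesFresh_le i c hi
    rw [freshTime_eq (lt_of_le_of_lt hl hk) hb]
    exact hP _ _ (deliveryTime_mono hc (by omega)) hp
  · intro hp
    obtain ⟨k, hk, hb⟩ := exists_becomesFresh i hc
    exact ⟨k, hk, hb.2, freshTime_eq hk hb ▸ hp⟩

/-- The first `l` deliveries consult only rows below `l`. Row `k` can thus be resampled while the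
past is frozen. -/
lemma freshAfter_update (c : Fin n → Fin n → ℝ) (k : Fin n) (y : Fin n → ℝ) {l : ℕ}
    (hl : l ≤ k) : freshAfter (Function.update c k y) l = freshAfter c l := by
  induction l with
  | zero => rfl
  | succ l ih =>
    have hln : l < n := by omega
    have hne : (⟨l, hln⟩ : Fin n) ≠ k := by
      intro h
      have := congrArg Fin.val h
      simp only at this
      omega
    ext i
    rw [mem_freshAfter_succ _ hln, mem_freshAfter_succ _ hln, ih (by omega),
      Function.update_of_ne hne]

lemma deliveryTime_update (c : Fin n → Fin n → ℝ) (k : Fin n) (y : Fin n → ℝ) {l : ℕ}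
    (hl : l ≤ k) : deliveryTime (Function.update c k y) l = deliveryTime c l := by
  induction l with
  | zero => rfl
  | succ l ih =>
    have hln : l < n := by omega
    have hne : (⟨l, hln⟩ : Fin n) ≠ k := by
      intro h
      have := congrArg Fin.val h
      simp only at this
      omega
    rw [deliveryTime, deliveryTime, ih (by omega), dif_pos hln, dif_pos hln,
      freshAfter_update c k y (by omega), Function.update_of_ne hne]

/-! ### Measurability -/

lemma measurable_clock_apply (k i : Fin n) : Measurable fun c : Fin n → Fin n → ℝ => c k i :=
  (measurable_pi_apply i).comp (measurable_pi_apply k)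

lemma measurableSet_mem_freshAfter (k : ℕ) (i : Fin n) :
    MeasurableSet {c : Fin n → Fin n → ℝ | i ∈ freshAfter c k} := by
  induction k generalizing i with
  | zero => simp [freshAfter]
  | succ k ih =>
    by_cases hk : k < n
    · have : {c : Fin n → Fin n → ℝ | i ∈ freshAfter c (k + 1)} = {c | i ∈ freshAfter c k} ∪
          ({c | i ∈ freshAfter c k}ᶜ ∩
            ⋂ j, ({c | j ∈ freshAfter c k} ∪ {c | c ⟨k, hk⟩ i ≤ c ⟨k, hk⟩ j})) := by
        ext c
        simp only [Set.mem_ofPred_eq, mem_freshAfter_succ _ hk, Set.mem_union, Set.mem_inter_iff,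
          Set.mem_compl_iff, Set.mem_iInter, or_iff_not_imp_left]
      rw [this]
      exact (ih i).union ((ih i).compl.inter (MeasurableSet.iInter fun j => (ih j).union
        (measurableSet_le (measurable_clock_apply _ _) (measurable_clock_apply _ _))))
    · simpa [freshAfter, hk] using ih i

lemma measurableSet_freshAfter_eq (k : ℕ) (A : Finset (Fin n)) :
    MeasurableSet {c : Fin n → Fin n → ℝ | freshAfter c k = A} := by
  have : {c : Fin n → Fin n → ℝ | freshAfter c k = A} =
      ⋂ j, {c | j ∈ freshAfter c k ↔ j ∈ A} := by
    ext c
    simp [Finset.ext_iff]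
  rw [this]
  refine MeasurableSet.iInter fun j => ?_
  by_cases hj : j ∈ A
  · simpa only [hj, iff_true] using measurableSet_mem_freshAfter k j
  · simp only [hj, iff_false]
    exact (measurableSet_mem_freshAfter k j).compl

lemma measurable_deliveryTime (k : ℕ) :
    Measurable fun c : Fin n → Fin n → ℝ => deliveryTime c k := by
  induction k with
  | zero => exact measurable_const
  | succ k ih =>
    by_cases hk : k < n
    · simp only [deliveryTime, dif_pos hk]
      refine ih.add ?_
      classical
      -- The index set of the infimum depends on `c`; split according to its finitely many values.
      have : (fun c : Fin n → Fin n → ℝ => ⨅ i : {i : Fin n // i ∉ freshAfter c k},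
          c ⟨k, hk⟩ i.1) = fun c => ∑ A : Finset (Fin n), {c | freshAfter c k = A}.indicator
          (fun c => ⨅ i : {i : Fin n // i ∉ A}, c ⟨k, hk⟩ i.1) c := by
        funext c
        rw [Finset.sum_eq_single_of_mem (freshAfter c k) (Finset.mem_univ _)]
        · rw [Set.indicator_of_mem (by rfl)]
        · intro A _ hA
          exact Set.indicator_of_notMem (fun h => hA h.symm) _
      rw [this]
      refine Finset.measurable_sum _ fun A _ => Measurable.indicator ?_
        (measurableSet_freshAfter_eq k A)
      exact Measurable.iInf fun i => measurable_clock_apply _ _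
    · simpa [deliveryTime, hk] using ih

lemma measurableSet_becomesFresh (i : Fin n) (k : ℕ) :
    MeasurableSet {c : Fin n → Fin n → ℝ | BecomesFresh i k c} :=
  (measurableSet_mem_freshAfter k i).compl.inter (measurableSet_mem_freshAfter (k + 1) i)

lemma measurable_freshTime (i : Fin n) : Measurable (freshTime i) := by
  unfold freshTime
  exact Finset.measurable_sum _ fun k _ =>
    Measurable.ite (measurableSet_becomesFresh i k) (measurable_deliveryTime _) measurable_const

/-! ### The law of one cycle -/

/-- The law of the clocks of one cycle. -/
def cycleLaw (n : ℕ) (lamS : ℝ) : Measure (Fin n → Fin n → ℝ) :=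
  Measure.pi fun k : Fin n => Measure.pi fun _ : Fin n =>
    expMeasure (lamS / ((n : ℝ) - ((k : ℕ) : ℝ)))

lemma clock_rate_pos {lamS : ℝ} (hS : 0 < lamS) {k : ℕ} (hk : k < n) :
    0 < lamS / ((n : ℝ) - (k : ℝ)) := by
  have : (k : ℝ) < n := by exact_mod_cast hk
  exact div_pos hS (by linarith)

lemma isProbabilityMeasure_clock {lamS : ℝ} (hS : 0 < lamS) (k : Fin n) :
    IsProbabilityMeasure (expMeasure (lamS / ((n : ℝ) - ((k : ℕ) : ℝ)))) :=
  isProbabilityMeasure_expMeasure (clock_rate_pos hS k.2)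

lemma isProbabilityMeasure_cycleLaw {lamS : ℝ} (hS : 0 < lamS) :
    IsProbabilityMeasure (cycleLaw n lamS) := by
  have := isProbabilityMeasure_clock (n := n) hS
  unfold cycleLaw
  infer_instance

/-- Independent variables with laws without atoms almost surely differ. -/
lemma ae_pi_ne {ι : Type*} [Fintype ι] (μ : ι → Measure ℝ) [∀ i, IsProbabilityMeasure (μ i)]
    [∀ i, NullSingletonClass (μ i)] {i j : ι} (hij : i ≠ j) :
    ∀ᵐ y ∂Measure.pi μ, y i ≠ y j := by
  classical
  have hm : MeasurableSet {y : ι → ℝ | y i = y j} :=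
    measurableSet_eq_fun (measurable_pi_apply i) (measurable_pi_apply j)
  have h : Measure.pi μ {y : ι → ℝ | y i = y j} = 0 := by
    -- With coordinate `i` resampled, the event becomes `u = y j`, a singleton, which is null.
    rw [← lintegral_indicator_one hm, lintegral_pi_update μ (measurable_one.indicator hm) i,
      lintegral_eq_zero_of_ae_eq_zero]
    filter_upwards with y
    have h1 : ∀ u, ({y : ι → ℝ | y i = y j}.indicator 1 (Function.update y i u) : ℝ≥0∞) =
        ({y j} : Set ℝ).indicator 1 u := by
      intro u
      by_cases hu : u = y j
      · simp [hu, hij.symm]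
      · simp [hu, hij.symm]
    simp_rw [h1]
    rw [lintegral_indicator_one (measurableSet_singleton _), measure_singleton]
    rfl
  rw [ae_iff]
  simpa using h

lemma ae_regularClocks {lamS : ℝ} (hS : 0 < lamS) :
    ∀ᵐ c ∂cycleLaw n lamS, RegularClocks c := by
  have := isProbabilityMeasure_clock (n := n) hS
  have hrow : ∀ k : Fin n, ∀ p : (Fin n → ℝ) → Prop,
      (∀ᵐ y ∂Measure.pi fun _ : Fin n => expMeasure (lamS / ((n : ℝ) - ((k : ℕ) : ℝ))), p y) →
      ∀ᵐ c ∂cycleLaw n lamS, p (c k) := fun k p hp =>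
    (Measure.quasiMeasurePreserving_eval (μ := fun k : Fin n => Measure.pi fun _ : Fin n =>
      expMeasure (lamS / ((n : ℝ) - ((k : ℕ) : ℝ)))) k).ae hp
  refine Filter.Eventually.and ?_ ?_
  · refine ae_all_iff.2 fun k => ae_all_iff.2 fun i => hrow k (fun y => 0 < y i) ?_
    exact (Measure.quasiMeasurePreserving_eval (μ := fun _ : Fin n =>
      expMeasure (lamS / ((n : ℝ) - ((k : ℕ) : ℝ)))) i).ae
      (ae_pos_expMeasure (clock_rate_pos hS k.2))
  · refine ae_all_iff.2 fun k => hrow k Function.Injective ?_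
    have : ∀ i j : Fin n, i ≠ j → ∀ᵐ y ∂Measure.pi fun _ : Fin n =>
        expMeasure (lamS / ((n : ℝ) - ((k : ℕ) : ℝ))), y i ≠ y j := fun i j hij => ae_pi_ne _ hij
    have : ∀ᵐ y ∂Measure.pi fun _ : Fin n => expMeasure (lamS / ((n : ℝ) - ((k : ℕ) : ℝ))),
        ∀ i j : Fin n, i ≠ j → y i ≠ y j := by
      simpa only [ae_all_iff] using this
    filter_upwards [this] with y hy i j h
    by_contra hne
    exact hy i j hne h

/-! ### Laplace transform of the time to freshness -/

/-- The Laplace functional of the `k`-th delivery time on the event `s`. -/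
def deliveryLaplace (lamS a : ℝ) (k : ℕ) (s : Set (Fin n → Fin n → ℝ)) : ℝ≥0∞ :=
  ∫⁻ c, s.indicator (fun c => ENNReal.ofReal (Real.exp (-(a * deliveryTime c k)))) c
    ∂cycleLaw n lamS

lemma measurable_exp_deliveryTime (a : ℝ) (k : ℕ) :
    Measurable fun c : Fin n → Fin n → ℝ =>
      ENNReal.ofReal (Real.exp (-(a * deliveryTime c k))) := by
  have := measurable_deliveryTime (n := n) k
  fun_prop

lemma measurableSet_freshAfter_mem (k : ℕ) (S : Set (Finset (Fin n))) :
    MeasurableSet {c : Fin n → Fin n → ℝ | freshAfter c k ∈ S} := by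
  have : {c : Fin n → Fin n → ℝ | freshAfter c k ∈ S} = ⋃ A ∈ S, {c | freshAfter c k = A} := by
    ext c
    simp
  rw [this]
  exact MeasurableSet.biUnion S.to_countable fun A _ => measurableSet_freshAfter_eq k A

lemma measurableSet_freshAfter_mem_and_becomesFresh (k : ℕ) (S : Set (Finset (Fin n)))
    (j : Fin n) :
    MeasurableSet {c : Fin n → Fin n → ℝ | freshAfter c k ∈ S ∧ BecomesFresh j k c} :=
  (measurableSet_freshAfter_mem k S).inter (measurableSet_becomesFresh j k)

lemma measurableSet_freshAfter_mem_and_notMem (k : ℕ) (S : Set (Finset (Fin n))) (j : Fin n) :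
    MeasurableSet {c : Fin n → Fin n → ℝ | freshAfter c k ∈ S ∧ j ∉ freshAfter c k} :=
  (measurableSet_freshAfter_mem k S).inter (measurableSet_mem_freshAfter k j).compl

/-- Delivery `k + 1` goes to each stale node `j` with the same probability, independently of the
past and of the time since delivery `k`. -/
lemma deliveryLaplace_becomesFresh {lamS a : ℝ} (hS : 0 < lamS) (ha : 0 ≤ a) {k : ℕ} (hk : k < n)
    (S : Set (Finset (Fin n))) (j : Fin n) :
    deliveryLaplace lamS a (k + 1) {c | freshAfter c k ∈ S ∧ BecomesFresh j k c} =
      deliveryLaplace lamS a k {c : Fin n → Fin n → ℝ | freshAfter c k ∈ S ∧ j ∉ freshAfter c k} *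
        ENNReal.ofReal (lamS / ((n : ℝ) - (k : ℝ)) / (lamS + a)) := by
  have hprob := isProbabilityMeasure_clock (n := n) hS
  have hρ := clock_rate_pos hS hk
  have hm1 := measurableSet_freshAfter_mem_and_becomesFresh k S j
  have hm2 := measurableSet_freshAfter_mem_and_notMem k S j
  unfold deliveryLaplace
  rw [← lintegral_mul_const _ ((measurable_exp_deliveryTime a k).indicator hm2)]
  -- Resample row `k` only: it decides delivery `k + 1`, while the earlier rows fix the stale set
  -- and `deliveryTime c k`.
  rw [cycleLaw, lintegral_pi_update _ ((measurable_exp_deliveryTime a (k + 1)).indicator hm1)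
    ⟨k, hk⟩, ← cycleLaw]
  refine lintegral_congr_ae ?_
  filter_upwards [ae_regularClocks hS] with c hc
  by_cases hcs : freshAfter c k ∈ S ∧ j ∉ freshAfter c k
  · have hf : ∀ y : Fin n → ℝ,
        {c | freshAfter c k ∈ S ∧ BecomesFresh j k c}.indicator
          (fun c => ENNReal.ofReal (Real.exp (-(a * deliveryTime c (k + 1)))))
          (Function.update c ⟨k, hk⟩ y) =
        ENNReal.ofReal (Real.exp (-(a * deliveryTime c k))) *
          {y : Fin n → ℝ | ∀ l ∈ (freshAfter c k)ᶜ, y j ≤ y l}.indicator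
            (fun y => ENNReal.ofReal (Real.exp (-(a * y j)))) y := by
      intro y
      have hA := freshAfter_update c ⟨k, hk⟩ y (le_refl k)
      have hT := deliveryTime_update c ⟨k, hk⟩ y (le_refl k)
      have hiff : Function.update c ⟨k, hk⟩ y ∈
          {c | freshAfter c k ∈ S ∧ BecomesFresh j k c} ↔
          y ∈ {y : Fin n → ℝ | ∀ l ∈ (freshAfter c k)ᶜ, y j ≤ y l} := by
        simp only [Set.mem_ofPred_eq, becomesFresh_iff j hk, hA, Function.update_self,
          Finset.mem_compl, hcs.1, hcs.2, true_and, not_false_eq_true]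
      by_cases hy : y ∈ {y : Fin n → ℝ | ∀ l ∈ (freshAfter c k)ᶜ, y j ≤ y l}
      · rw [Set.indicator_of_mem (hiff.2 hy), Set.indicator_of_mem hy,
          deliveryTime_succ_of_argmin _ hk (i := j) (by rw [hA]; exact hcs.2)
            (by
              intro l hl
              rw [hA] at hl
              rw [Function.update_self]
              exact hy l (by simpa using hl)), hT, Function.update_self,
          ← ENNReal.ofReal_mul (Real.exp_pos _).le, ← Real.exp_add]
        congr 2
        ring
      · rw [Set.indicator_of_notMem (mt hiff.1 hy), Set.indicator_of_notMem hy, mul_zero]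
    simp_rw [hf]
    have hmem : c ∈ {c : Fin n → Fin n → ℝ | freshAfter c k ∈ S ∧ j ∉ freshAfter c k} := hcs
    rw [Set.indicator_of_mem hmem, lintegral_const_mul' _ _ ENNReal.ofReal_ne_top,
      lintegral_pi_expMeasure_argmin hρ ha _ (by simpa using hcs.2), Finset.card_compl,
      card_freshAfter hc hk.le, Fintype.card_fin, Nat.cast_sub hk.le]
    have hkn : (n : ℝ) - (k : ℝ) ≠ 0 := by
      have : (k : ℝ) < n := by exact_mod_cast hk
      linarith
    -- The rate-changing rule enters here: `n - k` clocks of rate `lamS / (n - k)` have total rate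
    -- `lamS`.
    rw [mul_div_cancel₀ _ hkn]
  · have hmem : c ∉ {c : Fin n → Fin n → ℝ | freshAfter c k ∈ S ∧ j ∉ freshAfter c k} := hcs
    rw [Set.indicator_of_notMem hmem, zero_mul]
    refine lintegral_eq_zero_of_ae_eq_zero (Eventually.of_forall fun y => ?_)
    refine Set.indicator_of_notMem (fun h => hcs ?_) _
    have hA := freshAfter_update c ⟨k, hk⟩ y (le_refl k)
    have h' := h
    simp only [Set.mem_ofPred_eq, BecomesFresh, hA] at h'
    exact ⟨h'.1, h'.2.1⟩

/-- The Laplace functional of the `k`-th delivery time on the event that node `i` is still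
stale. -/
lemma deliveryLaplace_stale {lamS a : ℝ} (hS : 0 < lamS) (ha : 0 ≤ a) (i : Fin n) {k : ℕ}
    (hk : k ≤ n) :
    deliveryLaplace lamS a k {c : Fin n → Fin n → ℝ | i ∉ freshAfter c k} =
      ENNReal.ofReal ((lamS / (lamS + a)) ^ k * (((n : ℝ) - k) / n)) := by
  have hn : (0 : ℝ) < n := by exact_mod_cast i.pos
  have := isProbabilityMeasure_cycleLaw (n := n) hS
  induction k with
  | zero =>
    simp [deliveryLaplace, freshAfter, deliveryTime, hn.ne']
  | succ k ih =>
    have hk' : k < n := hk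
    have hkn : (0 : ℝ) < (n : ℝ) - k := by
      have : (k : ℝ) < n := by exact_mod_cast hk'
      linarith
    have ih := ih hk'.le
    have hmE := measurableSet_freshAfter_mem_and_becomesFresh k {A : Finset (Fin n) | i ∉ A}
    have hmN := measurableSet_freshAfter_mem_and_notMem k {A : Finset (Fin n) | i ∉ A}
    -- Node `i` stays stale exactly when it was stale and delivery `k + 1` goes to some `j ≠ i`;
    -- almost surely this `j` is unique.
    have h1 : deliveryLaplace lamS a (k + 1) {c : Fin n → Fin n → ℝ | i ∉ freshAfter c (k + 1)} =
        ∑ j ∈ Finset.univ.erase i, deliveryLaplace lamS a (k + 1)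
          {c | freshAfter c k ∈ {A | i ∉ A} ∧ BecomesFresh j k c} := by
      unfold deliveryLaplace
      rw [← lintegral_finsetSum _ fun j _ =>
        (measurable_exp_deliveryTime a (k + 1)).indicator (hmE j)]
      refine lintegral_congr_ae ?_
      filter_upwards [ae_regularClocks hS] with c hc
      obtain ⟨j, hj⟩ := exists_becomesFresh_iff_eq hc hk'
      have hij := hj i
      simp only [BecomesFresh] at hij
      by_cases hi : i ∈ freshAfter c (k + 1)
      · rw [Set.indicator_of_notMem (by simpa using hi), Finset.sum_eq_zero]
        intro l hl
        refine Set.indicator_of_notMem (fun h => ?_) _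
        simp only [Set.mem_ofPred_eq, hj] at h
        rw [h.2, ← hij.1 ⟨h.1, hi⟩] at hl
        simp at hl
      · have hi' : i ∉ freshAfter c k := fun h => hi (freshAfter_mono c (Nat.le_succ k) h)
        have hne : i ≠ j := fun h => hi (hij.2 h).2
        rw [Set.indicator_of_mem (by simpa using hi),
          Finset.sum_eq_single_of_mem j (by simpa using hne.symm)]
        · rw [Set.indicator_of_mem]
          exact ⟨hi', (hj j).2 rfl⟩
        · intro l _ hl
          refine Set.indicator_of_notMem (fun h => ?_) _
          simp only [Set.mem_ofPred_eq, hj] at h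
          exact hl h.2
    -- While `i` is stale, `n - (k + 1)` other nodes are stale. The resulting factors `(n - k - 1) /
    -- (n - k)` telescope.
    have h2 : ∑ j ∈ Finset.univ.erase i, deliveryLaplace lamS a k
          {c : Fin n → Fin n → ℝ | freshAfter c k ∈ {A | i ∉ A} ∧ j ∉ freshAfter c k} =
        ((n - (k + 1) : ℕ) : ℝ≥0∞) *
          deliveryLaplace lamS a k {c : Fin n → Fin n → ℝ | i ∉ freshAfter c k} := by
      unfold deliveryLaplace
      rw [← lintegral_finsetSum _ fun j _ =>
        (measurable_exp_deliveryTime a k).indicator (hmN j),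
        ← lintegral_const_mul' _ _ (by finiteness)]
      refine lintegral_congr_ae ?_
      filter_upwards [ae_regularClocks hS] with c hc
      by_cases hi : i ∈ freshAfter c k
      · rw [Set.indicator_of_notMem (by simpa using hi), mul_zero, Finset.sum_eq_zero]
        intro l hl
        exact Set.indicator_of_notMem (fun h => h.1 hi) _
      · rw [Set.indicator_of_mem (by simpa using hi)]
        have : ∀ j, {c : Fin n → Fin n → ℝ | i ∉ freshAfter c k ∧ j ∉ freshAfter c k}.indicator
            (fun c => ENNReal.ofReal (Real.exp (-(a * deliveryTime c k)))) c =
            if j ∈ (freshAfter c k)ᶜ then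
              ENNReal.ofReal (Real.exp (-(a * deliveryTime c k))) else 0 := by
          intro j
          simp [Set.indicator_apply, hi]
        rw [Finset.sum_congr rfl fun j _ => this j, Finset.sum_ite_mem, Finset.sum_const, nsmul_eq_mul, Finset.erase_inter,
          Finset.univ_inter, Finset.card_erase_of_mem (by simpa using hi), Finset.card_compl,
          card_freshAfter hc hk'.le, Fintype.card_fin, Nat.sub_sub]
    rw [h1, Finset.sum_congr rfl fun j _ => deliveryLaplace_becomesFresh hS ha hk' {A | i ∉ A} j,
      ← Finset.sum_mul, h2, ih, ← ENNReal.ofReal_natCast, ← ENNReal.ofReal_mul (by positivity),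
      ← ENNReal.ofReal_mul (by positivity), Nat.cast_sub hk]
    congr 1
    have : lamS + a ≠ 0 := by linarith
    push_cast
    rw [pow_succ]
    field_simp

/-- The Laplace transform of the time at which node `i` becomes fresh. -/
lemma lintegral_exp_freshTime {lamS a : ℝ} (hS : 0 < lamS) (ha : 0 < a) (i : Fin n) :
    ∫⁻ c, ENNReal.ofReal (Real.exp (-(a * freshTime i c))) ∂cycleLaw n lamS =
      ENNReal.ofReal (lamS / (n * a) * (1 - (lamS / (lamS + a)) ^ n)) := by
  have hn : (0 : ℝ) < n := by exact_mod_cast i.pos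
  have hsa : 0 < lamS + a := by linarith
  have h1 : ∫⁻ c, ENNReal.ofReal (Real.exp (-(a * freshTime i c))) ∂cycleLaw n lamS =
      ∑ k ∈ Finset.range n, deliveryLaplace lamS a (k + 1)
        {c : Fin n → Fin n → ℝ | freshAfter c k ∈ Set.univ ∧ BecomesFresh i k c} := by
    unfold deliveryLaplace
    rw [← lintegral_finsetSum _ fun k _ =>
      (measurable_exp_deliveryTime a (k + 1)).indicator
        (measurableSet_freshAfter_mem_and_becomesFresh k _ i)]
    refine lintegral_congr_ae ?_
    filter_upwards [ae_regularClocks hS] with c hc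
    obtain ⟨k, hk, hb⟩ := exists_becomesFresh i hc
    rw [freshTime_eq hk hb, Finset.sum_eq_single_of_mem k (Finset.mem_range.2 hk)]
    · rw [Set.indicator_of_mem]
      exact ⟨Set.mem_univ _, hb⟩
    · intro l _ hl
      exact Set.indicator_of_notMem (fun h => hl (h.2.unique hb)) _
  -- Being stale contributes `(n - k) / n` and being chosen `1 / (n - k)`: the rank of `i` among the
  -- deliveries is uniform.
  have h2 : ∀ k ∈ Finset.range n, deliveryLaplace lamS a (k + 1)
        {c : Fin n → Fin n → ℝ | freshAfter c k ∈ Set.univ ∧ BecomesFresh i k c} =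
      ENNReal.ofReal ((lamS / (lamS + a)) ^ k * (lamS / (lamS + a) / n)) := by
    intro k hk
    rw [Finset.mem_range] at hk
    have hkn : (0 : ℝ) < (n : ℝ) - k := by
      have : (k : ℝ) < n := by exact_mod_cast hk
      linarith
    rw [deliveryLaplace_becomesFresh hS ha.le hk]
    simp only [Set.mem_univ, true_and]
    rw [deliveryLaplace_stale hS ha.le i hk.le, ← ENNReal.ofReal_mul (by positivity)]
    congr 1
    field_simp
  rw [h1, Finset.sum_congr rfl h2, ← ENNReal.ofReal_sum_of_nonneg fun k _ => by positivity,
    ← Finset.sum_mul, geom_sum_eq]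
  · congr 1
    have : lamS / (lamS + a) - 1 = -(a / (lamS + a)) := by
      field_simp
      ring
    rw [this]
    generalize (lamS / (lamS + a)) ^ n = q
    field_simp
    ring
  · intro h
    rw [div_eq_one_iff_eq hsa.ne'] at h
    linarith

/-! ### Laws and independence of the clocks -/

namespace Clocks

variable {n : ℕ} {lamS lamE : ℝ} {Ω : Type*} [MeasurableSpace Ω] {P : Measure Ω}

/-- All clocks of cycle `j`. -/
def cycleClock (N : Clocks n lamS lamE P) (j : ℕ) (ω : Ω) : Fin n → Fin n → ℝ :=
  fun k i => N.clock j k i ω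

lemma measurable_cycleClock (N : Clocks n lamS lamE P) (j : ℕ) : Measurable (N.cycleClock j) :=
  measurable_pi_lambda _ fun k => measurable_pi_lambda _ fun i => N.measurable_clock j k i

lemma measurable_cycleStart (N : Clocks n lamS lamE P) (j : ℕ) : Measurable (N.cycleStart j) := by
  unfold cycleStart
  exact Finset.measurable_sum _ fun l _ => N.measurable_selfGap l

lemma cycleStart_succ (N : Clocks n lamS lamE P) (j : ℕ) (ω : Ω) :
    N.cycleStart (j + 1) ω = N.cycleStart j ω + N.selfGap j ω :=
  Finset.sum_range_succ _ _

lemma measurable_all (N : Clocks n lamS lamE P) (a : ℕ ⊕ ℕ × Fin n × Fin n) :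
    Measurable (Sum.elim N.selfGap (fun a : ℕ × Fin n × Fin n => N.clock a.1 a.2.1 a.2.2) a) := by
  rcases a with j | a
  · exact N.measurable_selfGap j
  · exact N.measurable_clock _ _ _

/-- Independence gives a product law indexed by pairs; currying turns it into the nested product of
`cycleLaw`. -/
lemma map_cycleClock [IsProbabilityMeasure P] (hS : 0 < lamS) (N : Clocks n lamS lamE P) (j : ℕ) :
    P.map (N.cycleClock j) = cycleLaw n lamS := by
  have hprob := isProbabilityMeasure_clock (n := n) hS
  have hinj : Function.Injective
      (fun p : Fin n × Fin n => (Sum.inr (j, p) : ℕ ⊕ ℕ × Fin n × Fin n)) := by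
    intro p q h
    simpa using h
  have hind : iIndepFun (fun (p : Fin n × Fin n) => N.clock j p.1 p.2) P := N.indep.precomp hinj
  have hmap : P.map (fun ω (p : Fin n × Fin n) => N.clock j p.1 p.2 ω) =
      Measure.infinitePi fun p : Fin n × Fin n =>
        expMeasure (lamS / ((n : ℝ) - ((p.1 : ℕ) : ℝ))) := by
    rw [hind.map_fun_eq_infinitePi_map fun p : Fin n × Fin n => N.measurable_clock j p.1 p.2]
    simp_rw [N.law_clock]
  have hcurry := Measure.infinitePi_map_curry (fun k _ : Fin n =>
    expMeasure (lamS / ((n : ℝ) - ((k : ℕ) : ℝ))))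
  rw [← hmap, Measure.map_map (MeasurableEquiv.measurable _)
    (measurable_pi_lambda _ fun p : Fin n × Fin n => N.measurable_clock j p.1 p.2)] at hcurry
  simp_rw [Measure.infinitePi_eq_pi] at hcurry
  exact hcurry

lemma indepFun_cycleStart_selfGap (N : Clocks n lamS lamE P) (j : ℕ) :
    IndepFun (N.cycleStart j) (N.selfGap j) P := by
  classical
  have h := N.indep.indepFun_finset ((Finset.range j).image Sum.inl) {Sum.inl j}
    (by simpa [Finset.disjoint_left] using fun a ha => Nat.ne_of_lt ha) N.measurable_all
  let f : ((a : ((Finset.range j).image Sum.inl : Finset (ℕ ⊕ ℕ × Fin n × Fin n))) → ℝ) → ℝ :=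
    fun v => ∑ l ∈ (Finset.range j).attach, v ⟨Sum.inl l.1, Finset.mem_image_of_mem _ l.2⟩
  let g : ((a : ({Sum.inl j} : Finset (ℕ ⊕ ℕ × Fin n × Fin n))) → ℝ) → ℝ :=
    fun v => v ⟨Sum.inl j, Finset.mem_singleton_self _⟩
  have hf : Measurable f := Finset.measurable_sum _ fun l _ => measurable_pi_apply _
  have hg : Measurable g := measurable_pi_apply _
  have h2 := h.comp hf hg
  convert! h2 using 1
  funext ω
  exact (Finset.sum_attach (Finset.range j) fun l => N.selfGap l ω).symm

/-- The pair depends only on the gaps `0, …, j`, disjoint from the node clocks. Joint independence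
is needed because freshness involves both ends of the cycle. -/
lemma indepFun_cycleClock (N : Clocks n lamS lamE P) (j : ℕ) :
    IndepFun (N.cycleClock j) (fun ω => (N.cycleStart j ω, N.selfGap j ω)) P := by
  classical
  have h := N.indep.indepFun_finset
    ((Finset.univ : Finset (Fin n × Fin n)).image fun p => Sum.inr (j, p))
    ((Finset.range (j + 1)).image Sum.inl)
    (by
      rw [Finset.disjoint_left]
      intro a ha hb
      simp only [Finset.mem_image] at ha hb
      obtain ⟨p, _, rfl⟩ := ha
      obtain ⟨l, _, hl⟩ := hb
      cases hl) N.measurable_all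
  let f : ((a : ((Finset.univ : Finset (Fin n × Fin n)).image fun p => Sum.inr (j, p) :
      Finset (ℕ ⊕ ℕ × Fin n × Fin n))) → ℝ) → (Fin n → Fin n → ℝ) :=
    fun v k i => v ⟨Sum.inr (j, k, i), Finset.mem_image_of_mem _ (Finset.mem_univ (k, i))⟩
  let g : ((a : ((Finset.range (j + 1)).image Sum.inl : Finset (ℕ ⊕ ℕ × Fin n × Fin n))) → ℝ) →
      ℝ × ℝ := fun v =>
    (∑ l ∈ (Finset.range j).attach, v ⟨Sum.inl l.1, Finset.mem_image_of_mem _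
      (Finset.mem_range.2 ((Finset.mem_range.1 l.2).trans (Nat.lt_succ_self j)))⟩,
      v ⟨Sum.inl j, Finset.mem_image_of_mem _ (Finset.self_mem_range_succ j)⟩)
  have hf : Measurable f :=
    measurable_pi_lambda _ fun k => measurable_pi_lambda _ fun i => measurable_pi_apply _
  have hg : Measurable g := by
    refine Measurable.prodMk ?_ (measurable_pi_apply _)
    exact Finset.measurable_sum _ fun l _ => measurable_pi_apply _
  have h2 := h.comp hf hg
  convert! h2 using 1
  funext ω
  refine Prod.ext ?_ rfl
  exact (Finset.sum_attach (Finset.range j) fun l => N.selfGap l ω).symm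

lemma map_cycleStart_selfGap [IsProbabilityMeasure P] (N : Clocks n lamS lamE P) (j : ℕ) :
    P.map (fun ω => (N.cycleStart j ω, N.selfGap j ω)) =
      (P.map (N.cycleStart j)).prod (expMeasure lamE) := by
  rw [(indepFun_iff_map_prod_eq_prod_map_map (N.measurable_cycleStart j).aemeasurable
    (N.measurable_selfGap j).aemeasurable).1 (N.indepFun_cycleStart_selfGap j), N.law_selfGap]

/-! ### Regular realizations and freshness along a path -/

/-- The realizations of the clocks without coincidences and explosions. -/
structure Regular (N : Clocks n lamS lamE P) (ω : Ω) : Prop where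
  selfGap_pos : ∀ j, 0 < N.selfGap j ω
  tendsto_cycleStart : Tendsto (fun j => N.cycleStart j ω) atTop atTop
  regularClocks : ∀ j, RegularClocks (N.cycleClock j ω)

lemma ae_selfGap_pos (hE : 0 < lamE) (N : Clocks n lamS lamE P) :
    ∀ᵐ ω ∂P, ∀ j, 0 < N.selfGap j ω := by
  rw [ae_all_iff]
  intro j
  have h := ae_pos_expMeasure hE
  rw [← N.law_selfGap j] at h
  exact ae_of_ae_map (N.measurable_selfGap j).aemeasurable h

/-- By the second Borel–Cantelli lemma infinitely many gaps exceed `1`: these events are independent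
with a common positive probability. -/
lemma ae_tendsto_cycleStart [IsProbabilityMeasure P] (hE : 0 < lamE) (N : Clocks n lamS lamE P) :
    ∀ᵐ ω ∂P, Tendsto (fun j => N.cycleStart j ω) atTop atTop := by
  have hm : ∀ j, MeasurableSet (N.selfGap j ⁻¹' Set.Ioi 1) := fun j =>
    N.measurable_selfGap j measurableSet_Ioi
  have hind : iIndepFun N.selfGap P := N.indep.precomp (g := Sum.inl) Sum.inl_injective
  have hset : iIndepSet (fun j => N.selfGap j ⁻¹' Set.Ioi 1) P :=
    (iIndepSet_iff_meas_biInter hm).2 fun s =>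
      hind.meas_biInter fun j _ => ⟨_, measurableSet_Ioi, rfl⟩
  have hsum : ∑' j, P (N.selfGap j ⁻¹' Set.Ioi 1) = ⊤ := by
    have : ∀ j, P (N.selfGap j ⁻¹' Set.Ioi 1) = ENNReal.ofReal (Real.exp (-(lamE * 1))) := by
      intro j
      rw [← Measure.map_apply (N.measurable_selfGap j) measurableSet_Ioi, N.law_selfGap,
        expMeasure_Ioi hE zero_le_one]
    simp_rw [this]
    exact ENNReal.tsum_const_eq_top_of_ne_zero (by simp [Real.exp_pos])
  have hlim := measure_limsup_eq_one hm hset hsum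
  have hio : ∀ᵐ ω ∂P, ∃ᶠ j in atTop, ω ∈ N.selfGap j ⁻¹' Set.Ioi 1 := by
    have h := (mem_ae_iff_prob_eq_one (MeasurableSet.measurableSet_limsup hm)).2 hlim
    filter_upwards [h] with ω hω
    exact mem_limsup_iff_frequently_mem.1 hω
  filter_upwards [N.ae_selfGap_pos hE, hio] with ω hω hf
  have hmono : Monotone fun j => N.cycleStart j ω := monotone_nat_of_le_succ fun j => by
    rw [N.cycleStart_succ]
    linarith [hω j]
  refine tendsto_atTop_atTop_of_monotone hmono fun b => ?_
  obtain ⟨m, hm⟩ := exists_nat_ge b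
  suffices h : ∀ m : ℕ, ∃ j, (m : ℝ) ≤ N.cycleStart j ω by
    obtain ⟨j, hj⟩ := h m
    exact ⟨j, hm.trans hj⟩
  intro m
  induction m with
  | zero => exact ⟨0, by simp [cycleStart]⟩
  | succ m ih =>
    obtain ⟨j, hj⟩ := ih
    obtain ⟨l, hl, hgap⟩ := frequently_atTop.1 hf j
    refine ⟨l + 1, ?_⟩
    have h1 : N.cycleStart j ω ≤ N.cycleStart l ω := hmono hl
    have h2 : 1 < N.selfGap l ω := hgap
    rw [N.cycleStart_succ]
    push_cast
    linarith

lemma ae_regular [IsProbabilityMeasure P] (hS : 0 < lamS) (hE : 0 < lamE)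
    (N : Clocks n lamS lamE P) : ∀ᵐ ω ∂P, N.Regular ω := by
  have hreg : ∀ᵐ ω ∂P, ∀ j, RegularClocks (N.cycleClock j ω) := by
    rw [ae_all_iff]
    intro j
    have h := ae_regularClocks (n := n) hS
    rw [← N.map_cycleClock hS j] at h
    exact ae_of_ae_map (N.measurable_cycleClock j).aemeasurable h
  filter_upwards [N.ae_selfGap_pos hE, N.ae_tendsto_cycleStart hE, hreg] with ω h1 h2 h3
  exact ⟨h1, h2, h3⟩

lemma Regular.strictMono {N : Clocks n lamS lamE P} {ω : Ω} (h : N.Regular ω) :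
    StrictMono fun j => N.cycleStart j ω := strictMono_nat_of_lt_succ fun j => by
  rw [N.cycleStart_succ]
  linarith [h.selfGap_pos j]

/-- Every time belongs to some cycle. -/
lemma Regular.exists_cycle {N : Clocks n lamS lamE P} {ω : Ω} (h : N.Regular ω) {t : ℝ}
    (ht : 0 ≤ t) : ∃ j, N.cycleStart j ω ≤ t ∧ t < N.cycleStart (j + 1) ω := by
  classical
  have hex : ∃ j, t < N.cycleStart j ω := (h.tendsto_cycleStart.eventually_gt_atTop t).exists
  have h0 : Nat.find hex ≠ 0 := by
    intro h0
    have := Nat.find_spec hex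
    rw [h0] at this
    simp [cycleStart] at this
    linarith
  obtain ⟨j, hj⟩ := Nat.exists_eq_succ_of_ne_zero h0
  refine ⟨j, not_lt.1 (Nat.find_min hex (by omega)), ?_⟩
  have := Nat.find_spec hex
  rwa [hj] at this

lemma Regular.cycle_unique {N : Clocks n lamS lamE P} {ω : Ω} (h : N.Regular ω) {t : ℝ} {j l : ℕ}
    (hj : N.cycleStart j ω ≤ t) (hj' : t < N.cycleStart (j + 1) ω)
    (hl : N.cycleStart l ω ≤ t) (hl' : t < N.cycleStart (l + 1) ω) : j = l := by
  have h1 : j < l + 1 := h.strictMono.lt_iff_lt.1 (hj.trans_lt hl')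
  have h2 : l < j + 1 := h.strictMono.lt_iff_lt.1 (hl.trans_lt hj')
  omega

lemma Regular.sourceVersion_eq {N : Clocks n lamS lamE P} {ω : Ω} (h : N.Regular ω) {t : ℝ} {j : ℕ}
    (hj : N.cycleStart j ω ≤ t) (hj' : t < N.cycleStart (j + 1) ω) :
    N.sourceVersion t ω = j + 1 := by
  have : {l : ℕ | N.cycleStart (l + 1) ω ≤ t} = Finset.range j := by
    ext l
    simp only [Set.mem_ofPred_eq, Finset.coe_range, Set.mem_Iio]
    constructor
    · intro hl
      have : l + 1 < j + 1 := h.strictMono.lt_iff_lt.1 (hl.trans_lt hj')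
      omega
    · intro hl
      exact (h.strictMono.monotone (Nat.succ_le_of_lt hl)).trans hj
  rw [sourceVersion, this, Set.ncard_coe_finset, Finset.card_range, add_comm]

lemma Regular.received_iff {N : Clocks n lamS lamE P} {ω : Ω} (h : N.Regular ω) (i : Fin n)
    (t : ℝ) (j : ℕ) :
    N.Received i j t ω ↔ N.cycleStart j ω + freshTime i (N.cycleClock j ω) ≤ t ∧
      N.cycleStart j ω + freshTime i (N.cycleClock j ω) < N.cycleStart (j + 1) ω :=
  exists_delivery_iff i (h.regularClocks j) (P := fun x => N.cycleStart j ω + x ≤ t ∧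
    N.cycleStart j ω + x < N.cycleStart (j + 1) ω)
    fun x y hxy hy => ⟨by linarith [hy.1], by linarith [hy.2]⟩

/-- In cycle `j`, node `i` holds the version of the source once it has become fresh. -/
lemma Regular.nodeVersion_eq_iff {N : Clocks n lamS lamE P} {ω : Ω} (h : N.Regular ω) (i : Fin n)
    {t : ℝ} {j : ℕ} (hj' : t < N.cycleStart (j + 1) ω) :
    N.nodeVersion i t ω = j + 1 ↔ N.cycleStart j ω + freshTime i (N.cycleClock j ω) ≤ t := by
  -- Cycles after `j` start after `t`, so the versions received are bounded and `sSup` is a true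
  -- maximum when the set is nonempty.
  have hbound : ∀ v ∈ {v : ℕ | ∃ l : ℕ, v = l + 1 ∧ N.Received i l t ω}, v ≤ j + 1 := by
    rintro v ⟨l, rfl, hl⟩
    have h1 := ((h.received_iff i t l).1 hl).1
    have h2 := freshTime_nonneg i (h.regularClocks l)
    have : l < j + 1 := h.strictMono.lt_iff_lt.1 (show N.cycleStart l ω < _ by linarith)
    omega
  have hiff : N.Received i j t ω ↔
      N.cycleStart j ω + freshTime i (N.cycleClock j ω) ≤ t := by
    rw [h.received_iff]
    exact ⟨fun h => h.1, fun h => ⟨h, h.trans_lt hj'⟩⟩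
  rw [← hiff, nodeVersion]
  constructor
  · intro hsup
    have hne : {v : ℕ | ∃ l : ℕ, v = l + 1 ∧ N.Received i l t ω}.Nonempty := by
      by_contra hemp
      rw [Set.not_nonempty_iff_eq_empty] at hemp
      -- The supremum of the empty set is `0`, never `j + 1`.
      rw [hemp] at hsup
      simp at hsup
    have hmem := Nat.sSup_mem hne ⟨j + 1, hbound⟩
    rw [hsup] at hmem
    obtain ⟨l, hl, hr⟩ := hmem
    obtain rfl : j = l := by omega
    exact hr
  · intro hr
    exact (show IsGreatest {v : ℕ | ∃ l : ℕ, v = l + 1 ∧ N.Received i l t ω} (j + 1) from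
      ⟨⟨j, rfl, hr⟩, hbound⟩).csSup_eq

/-- The pairs of a realization and a time at which node `i` is fresh. -/
def freshSet (N : Clocks n lamS lamE P) (i : Fin n) : Set (Ω × ℝ) :=
  ⋃ j : ℕ, {z | N.cycleStart j z.1 + freshTime i (N.cycleClock j z.1) ≤ z.2 ∧
    z.2 < N.cycleStart (j + 1) z.1}

lemma measurableSet_freshSet (N : Clocks n lamS lamE P) (i : Fin n) :
    MeasurableSet (N.freshSet i) := by
  refine MeasurableSet.iUnion fun j => MeasurableSet.inter ?_ ?_
  · exact measurableSet_le (((N.measurable_cycleStart j).comp measurable_fst).add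
      (((measurable_freshTime i).comp (N.measurable_cycleClock j)).comp measurable_fst))
      measurable_snd
  · exact measurableSet_lt measurable_snd ((N.measurable_cycleStart (j + 1)).comp measurable_fst)

lemma Regular.freshness_eq {N : Clocks n lamS lamE P} {ω : Ω} (h : N.Regular ω) (i : Fin n)
    {t : ℝ} (ht : 0 ≤ t) : N.freshness i t ω = (N.freshSet i).indicator 1 (ω, t) := by
  classical
  obtain ⟨j, hj, hj'⟩ := h.exists_cycle ht
  have hiff : (ω, t) ∈ N.freshSet i ↔
      N.cycleStart j ω + freshTime i (N.cycleClock j ω) ≤ t := by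
    simp only [freshSet, Set.mem_iUnion, Set.mem_ofPred_eq]
    constructor
    · rintro ⟨l, hl, hl'⟩
      have h2 := freshTime_nonneg i (h.regularClocks l)
      obtain rfl := h.cycle_unique hj hj' (by linarith) hl'
      exact hl
    · exact fun hle => ⟨j, hle, hj'⟩
  rw [freshness, h.sourceVersion_eq hj hj', Set.indicator_apply]
  simp only [h.nodeVersion_eq_iff i hj', hiff, Pi.one_apply]

/-! ### Self-updates in a time window -/

/-- Condition on the start `u` of cycle `j`: the independent gap must exceed `t - u`. -/
lemma prob_cycle_covers [IsProbabilityMeasure P] (hE : 0 < lamE) (N : Clocks n lamS lamE P)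
    (j : ℕ) {s t : ℝ} (hst : s ≤ t) :
    P {ω | N.cycleStart j ω ≤ s ∧ t < N.cycleStart (j + 1) ω} =
      ∫⁻ u, (Set.Iic s).indicator (fun u => ENNReal.ofReal (Real.exp (-(lamE * (t - u))))) u
        ∂P.map (N.cycleStart j) := by
  have := isProbabilityMeasure_expMeasure hE
  have hm : MeasurableSet {z : ℝ × ℝ | z.1 ≤ s ∧ t < z.1 + z.2} :=
    (measurableSet_le measurable_fst measurable_const).inter
      (measurableSet_lt measurable_const (measurable_fst.add measurable_snd))
  have h1 : {ω | N.cycleStart j ω ≤ s ∧ t < N.cycleStart (j + 1) ω} =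
      (fun ω => (N.cycleStart j ω, N.selfGap j ω)) ⁻¹' {z | z.1 ≤ s ∧ t < z.1 + z.2} := by
    ext ω
    simp [N.cycleStart_succ]
  rw [h1, ← Measure.map_apply ((N.measurable_cycleStart j).prodMk (N.measurable_selfGap j)) hm,
    N.map_cycleStart_selfGap, Measure.prod_apply hm]
  refine lintegral_congr fun u => ?_
  by_cases hu : u ≤ s
  · rw [Set.indicator_of_mem (Set.mem_Iic.2 hu), ← expMeasure_Ioi hE (by linarith)]
    congr 1
    ext x
    simp [hu, sub_lt_iff_lt_add']
  · rw [Set.indicator_of_notMem (by simpa using hu)]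
    have : Prod.mk u ⁻¹' {z : ℝ × ℝ | z.1 ≤ s ∧ t < z.1 + z.2} = ∅ := by
      ext x
      simp [hu]
    rw [this, measure_empty]

/-- The memoryless property of the self-updates. -/
lemma prob_cycle_covers_eq_mul [IsProbabilityMeasure P] (hE : 0 < lamE) (N : Clocks n lamS lamE P)
    (j : ℕ) {s t : ℝ} (hst : s ≤ t) :
    P {ω | N.cycleStart j ω ≤ s ∧ t < N.cycleStart (j + 1) ω} =
      ENNReal.ofReal (Real.exp (-(lamE * (t - s)))) *
        P {ω | N.cycleStart j ω ≤ s ∧ s < N.cycleStart (j + 1) ω} := by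
  rw [N.prob_cycle_covers hE j hst, N.prob_cycle_covers hE j le_rfl,
    ← lintegral_const_mul' _ _ ENNReal.ofReal_ne_top]
  refine lintegral_congr fun u => ?_
  by_cases hu : u ∈ Set.Iic s
  · rw [Set.indicator_of_mem hu, Set.indicator_of_mem hu, ← ENNReal.ofReal_mul (Real.exp_pos _).le,
      ← Real.exp_add]
    congr 2
    ring
  · rw [Set.indicator_of_notMem hu, Set.indicator_of_notMem hu, mul_zero]

lemma measurableSet_cycle_covers (N : Clocks n lamS lamE P) (j : ℕ) (s t : ℝ) :
    MeasurableSet {ω | N.cycleStart j ω ≤ s ∧ t < N.cycleStart (j + 1) ω} :=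
  (measurableSet_le (N.measurable_cycleStart j) measurable_const).inter
    (measurableSet_lt measurable_const (N.measurable_cycleStart (j + 1)))

/-- The probability that the source does not update itself in `(s, t]`. -/
lemma tsum_prob_cycle_covers [IsProbabilityMeasure P] (hS : 0 < lamS) (hE : 0 < lamE)
    (N : Clocks n lamS lamE P) {s t : ℝ} (hs : 0 ≤ s) (hst : s ≤ t) :
    ∑' j, P {ω | N.cycleStart j ω ≤ s ∧ t < N.cycleStart (j + 1) ω} =
      ENNReal.ofReal (Real.exp (-(lamE * (t - s)))) := by
  simp_rw [N.prob_cycle_covers_eq_mul hE _ hst]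
  -- What remains is the total probability that `s` lies in some cycle, which is one.
  rw [ENNReal.tsum_mul_left, ← measure_iUnion₀]
  · have : ∀ᵐ ω ∂P, ω ∈ ⋃ j, {ω | N.cycleStart j ω ≤ s ∧ s < N.cycleStart (j + 1) ω} := by
      filter_upwards [N.ae_regular hS hE] with ω hω
      obtain ⟨j, hj⟩ := hω.exists_cycle hs
      exact Set.mem_iUnion.2 ⟨j, hj⟩
    rw [(mem_ae_iff_prob_eq_one (MeasurableSet.iUnion fun j =>
      N.measurableSet_cycle_covers j s s)).1 this, mul_one]
  · intro j l hjl
    refine measure_mono_null (t := {ω | ¬ N.Regular ω}) ?_ (ae_iff.1 (N.ae_regular hS hE))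
    rintro ω ⟨hj, hl⟩ hω
    exact hjl (hω.cycle_unique hj.1 hj.2 hl.1 hl.2)
  · exact fun j => (N.measurableSet_cycle_covers j s s).nullMeasurableSet

/-- No cycle starts before time `0`. With `s = t - freshTime i c`, this produces the restriction
`freshTime i c ≤ t` in `prob_freshSet`. -/
lemma prob_cycle_covers_of_neg [IsProbabilityMeasure P] (hS : 0 < lamS) (hE : 0 < lamE)
    (N : Clocks n lamS lamE P) (j : ℕ) {s : ℝ} (t : ℝ) (hs : s < 0) :
    P {ω | N.cycleStart j ω ≤ s ∧ t < N.cycleStart (j + 1) ω} = 0 := by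
  refine measure_mono_null (t := {ω | ¬ N.Regular ω}) ?_ (ae_iff.1 (N.ae_regular hS hE))
  intro ω hj hω
  have h0 := hω.strictMono.monotone (Nat.zero_le j)
  have h1 : N.cycleStart 0 ω = 0 := by simp [cycleStart]
  have h2 := hj.1
  simp only [h1] at h0
  linarith

/-! ### Probability of freshness and its limit -/

/-- The node clocks of a cycle are independent of its two ends, so the time to freshness can be
frozen and integrated last. -/
lemma prob_fresh_in_cycle [IsProbabilityMeasure P] (hS : 0 < lamS) (N : Clocks n lamS lamE P)
    (i : Fin n) (j : ℕ) (t : ℝ) :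
    P {ω | N.cycleStart j ω + freshTime i (N.cycleClock j ω) ≤ t ∧
        t < N.cycleStart (j + 1) ω} =
      ∫⁻ c, P {ω | N.cycleStart j ω ≤ t - freshTime i c ∧ t < N.cycleStart (j + 1) ω}
        ∂cycleLaw n lamS := by
  have hm : MeasurableSet {z : (Fin n → Fin n → ℝ) × ℝ × ℝ |
      z.2.1 + freshTime i z.1 ≤ t ∧ t < z.2.1 + z.2.2} := by
    have h1 : Measurable fun z : (Fin n → Fin n → ℝ) × ℝ × ℝ => freshTime i z.1 :=
      (measurable_freshTime i).comp measurable_fst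
    have h2 : Measurable fun z : (Fin n → Fin n → ℝ) × ℝ × ℝ => z.2.1 :=
      measurable_fst.comp measurable_snd
    have h3 : Measurable fun z : (Fin n → Fin n → ℝ) × ℝ × ℝ => z.2.2 :=
      measurable_snd.comp measurable_snd
    exact (measurableSet_le (h2.add h1) measurable_const).inter
      (measurableSet_lt measurable_const (h2.add h3))
  have hSX := (N.measurable_cycleStart j).prodMk (N.measurable_selfGap j)
  have h1 : {ω | N.cycleStart j ω + freshTime i (N.cycleClock j ω) ≤ t ∧
        t < N.cycleStart (j + 1) ω} =
      (fun ω => (N.cycleClock j ω, N.cycleStart j ω, N.selfGap j ω)) ⁻¹'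
        {z | z.2.1 + freshTime i z.1 ≤ t ∧ t < z.2.1 + z.2.2} := by
    ext ω
    simp [N.cycleStart_succ]
  rw [h1, ← Measure.map_apply ((N.measurable_cycleClock j).prodMk hSX) hm,
    (indepFun_iff_map_prod_eq_prod_map_map (N.measurable_cycleClock j).aemeasurable
      hSX.aemeasurable).1 (N.indepFun_cycleClock j), Measure.prod_apply hm, N.map_cycleClock hS]
  refine lintegral_congr fun c => ?_
  rw [Measure.map_apply hSX (measurable_prodMk_left hm)]
  congr 1
  ext ω
  simp [N.cycleStart_succ, le_sub_iff_add_le]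

/-- The probability that node `i` is fresh at time `t`. -/
lemma prob_freshSet [IsProbabilityMeasure P] (hS : 0 < lamS) (hE : 0 < lamE)
    (N : Clocks n lamS lamE P) (i : Fin n) (t : ℝ) :
    P {ω | (ω, t) ∈ N.freshSet i} =
      ∫⁻ c, {c | freshTime i c ≤ t}.indicator
        (fun c => ENNReal.ofReal (Real.exp (-(lamE * freshTime i c)))) c ∂cycleLaw n lamS := by
  have h1 : {ω | (ω, t) ∈ N.freshSet i} = ⋃ j, {ω | N.cycleStart j ω +
      freshTime i (N.cycleClock j ω) ≤ t ∧ t < N.cycleStart (j + 1) ω} := by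
    ext ω
    simp [freshSet]
  rw [h1, measure_iUnion₀]
  · simp_rw [N.prob_fresh_in_cycle hS i]
    -- All cycles share the law `cycleLaw`, so the sum over `j` moves inside, where for fixed `c` it
    -- is the probability of no self-update in a window of length `freshTime i c`.
    rw [← lintegral_tsum]
    · refine lintegral_congr_ae ?_
      filter_upwards [ae_regularClocks hS] with c hc
      have h0 := freshTime_nonneg i hc
      by_cases hct : freshTime i c ≤ t
      · rw [Set.indicator_of_mem (by exact hct), N.tsum_prob_cycle_covers hS hE
          (sub_nonneg.2 hct) (by linarith), sub_sub_cancel]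
      · rw [Set.indicator_of_notMem (by exact hct)]
        simp_rw [fun j => N.prob_cycle_covers_of_neg hS hE j t (sub_neg.2 (not_le.1 hct))]
        exact tsum_zero
    · intro j
      -- Monotonicity in `s` gives measurability in `c`.
      have hanti : Monotone fun s => P {ω | N.cycleStart j ω ≤ s ∧
          t < N.cycleStart (j + 1) ω} := fun s s' hs =>
        measure_mono fun ω hω => ⟨hω.1.trans hs, hω.2⟩
      exact (hanti.measurable.comp (measurable_const.sub (measurable_freshTime i))).aemeasurable
  · intro j l hjl
    refine measure_mono_null (t := {ω | ¬ N.Regular ω}) ?_ (ae_iff.1 (N.ae_regular hS hE))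
    rintro ω ⟨hj, hl⟩ hω
    have h1 := freshTime_nonneg i (hω.regularClocks j)
    have h2 := freshTime_nonneg i (hω.regularClocks l)
    have h3 := hj.1
    have h4 := hl.1
    exact hjl (hω.cycle_unique (by linarith) hj.2 (by linarith) hl.2)
  · intro j
    refine MeasurableSet.nullMeasurableSet ?_
    exact (measurableSet_le ((N.measurable_cycleStart j).add
      ((measurable_freshTime i).comp (N.measurable_cycleClock j))) measurable_const).inter
      (measurableSet_lt measurable_const (N.measurable_cycleStart (j + 1)))

/-- The probability that node `i` is fresh at time `t` converges. -/
lemma tendsto_prob_freshSet [IsProbabilityMeasure P] (hS : 0 < lamS) (hE : 0 < lamE)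
    (N : Clocks n lamS lamE P) (i : Fin n) :
    Tendsto (fun t => P.real {ω | (ω, t) ∈ N.freshSet i}) atTop
      (𝓝 (lamS / (n * lamE) * (1 - (lamS / (lamS + lamE)) ^ n))) := by
  have hprob := isProbabilityMeasure_cycleLaw (n := n) hS
  have hm := measurable_freshTime i
  have hexp : Measurable fun c => ENNReal.ofReal (Real.exp (-(lamE * freshTime i c))) := by
    fun_prop
  have h : Tendsto (fun t => P {ω | (ω, t) ∈ N.freshSet i}) atTop
      (𝓝 (∫⁻ c, ENNReal.ofReal (Real.exp (-(lamE * freshTime i c))) ∂cycleLaw n lamS)) := by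
    simp_rw [N.prob_freshSet hS hE i]
    refine tendsto_lintegral_filter_of_dominated_convergence
      (fun c => ENNReal.ofReal (Real.exp (-(lamE * freshTime i c)))) ?_ ?_ ?_ ?_
    · exact Eventually.of_forall fun t =>
        hexp.indicator (measurableSet_le hm measurable_const)
    · exact Eventually.of_forall fun t => Eventually.of_forall fun c =>
        Set.indicator_le_self _ _ c
    · rw [lintegral_exp_freshTime hS hE]
      exact ENNReal.ofReal_ne_top
    · refine Eventually.of_forall fun c => tendsto_const_nhds.congr' ?_
      filter_upwards [eventually_ge_atTop (freshTime i c)] with t ht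
      rw [Set.indicator_of_mem (by exact ht)]
  rw [lintegral_exp_freshTime hS hE] at h
  have hle : (lamS / (lamS + lamE)) ^ n ≤ 1 :=
    pow_le_one₀ (by positivity) ((div_le_one (by positivity)).2 (by linarith))
  have h2 := (ENNReal.tendsto_toReal ENNReal.ofReal_ne_top).comp h
  rwa [ENNReal.toReal_ofReal (mul_nonneg (by positivity) (by linarith))] at h2

/-! ### Integrability and the time average -/

/-- Up to null sets, the freshness is the indicator function of a measurable set. -/
lemma freshness_ae_eq_indicator [IsProbabilityMeasure P] (hS : 0 < lamS) (hE : 0 < lamE)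
    (N : Clocks n lamS lamE P) (i : Fin n) (T : ℝ) :
    (fun z : Ω × ℝ => N.freshness i z.2 z.1) =ᵐ[P.prod (volume.restrict (Set.Ioc 0 T))]
      (N.freshSet i).indicator 1 := by
  have h1 : ∀ᵐ z ∂P.prod (volume.restrict (Set.Ioc 0 T)), N.Regular z.1 :=
    Measure.quasiMeasurePreserving_fst.ae (N.ae_regular hS hE)
  have h2 : ∀ᵐ z ∂P.prod (volume.restrict (Set.Ioc 0 T)), z.2 ∈ Set.Ioc 0 T :=
    Measure.quasiMeasurePreserving_snd.ae (ae_restrict_mem measurableSet_Ioc)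
  filter_upwards [h1, h2] with z hz hz2
  exact hz.freshness_eq i hz2.1.le

/-- Agreement almost everywhere with a measurable indicator suffices. This also licenses the Fubini
exchange in `integral_intervalIntegral_freshness`. -/
lemma integrable_freshness [IsProbabilityMeasure P] (hS : 0 < lamS) (hE : 0 < lamE)
    (N : Clocks n lamS lamE P) (i : Fin n) (T : ℝ) :
    Integrable (fun z : Ω × ℝ => N.freshness i z.2 z.1)
      (P.prod (volume.restrict (Set.Ioc 0 T))) := by
  refine Integrable.congr ?_ (N.freshness_ae_eq_indicator hS hE i T).symm
  exact (integrable_const (1 : ℝ)).indicator (N.measurableSet_freshSet i)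

lemma integral_freshness [IsProbabilityMeasure P] (hS : 0 < lamS) (hE : 0 < lamE)
    (N : Clocks n lamS lamE P) (i : Fin n) {t : ℝ} (ht : 0 ≤ t) :
    ∫ ω, N.freshness i t ω ∂P = P.real {ω | (ω, t) ∈ N.freshSet i} := by
  have hm : MeasurableSet {ω | (ω, t) ∈ N.freshSet i} :=
    measurable_prodMk_right (N.measurableSet_freshSet i)
  rw [← integral_indicator_one hm]
  refine integral_congr_ae ?_
  filter_upwards [N.ae_regular hS hE] with ω hω
  rw [hω.freshness_eq i ht]
  rfl

lemma integral_intervalIntegral_freshness [IsProbabilityMeasure P] (hS : 0 < lamS) (hE : 0 < lamE)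
    (N : Clocks n lamS lamE P) (i : Fin n) {T : ℝ} (hT : 0 ≤ T) :
    ∫ ω, (∫ t in (0 : ℝ)..T, N.freshness i t ω) ∂P =
      ∫ t in (0 : ℝ)..T, P.real {ω | (ω, t) ∈ N.freshSet i} := by
  simp_rw [intervalIntegral.integral_of_le hT]
  rw [integral_integral_swap (f := fun ω t => N.freshness i t ω)
    (N.integrable_freshness hS hE i T)]
  exact setIntegral_congr_fun measurableSet_Ioc fun t ht =>
    N.integral_freshness hS hE i ht.1.le

lemma averageFreshness_eq [IsProbabilityMeasure P] (hS : 0 < lamS) (hE : 0 < lamE)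
    (N : Clocks n lamS lamE P) (i : Fin n) :
    N.averageFreshness i = lamS / (n * lamE) * (1 - (lamS / (lamS + lamE)) ^ n) := by
  refine Tendsto.limsup_eq ?_
  have hmeas : Measurable fun t => P.real {ω | (ω, t) ∈ N.freshSet i} :=
    (measurable_measure_prodMk_right (N.measurableSet_freshSet i)).ennreal_toReal
  refine (tendsto_average_intervalIntegral hmeas (C := 1) (fun t => ?_)
    (N.tendsto_prob_freshSet hS hE i)).congr' ?_
  · rw [abs_of_nonneg measureReal_nonneg]
    exact measureReal_le_one
  · filter_upwards [eventually_ge_atTop 0] with T hT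
    rw [N.integral_intervalIntegral_freshness hS hE i hT]

end Clocks

end RCGossip

end

theorem mainTheorem2 {n : ℕ} {lamS lamE : ℝ} (hS : 0 < lamS) (hE : 0 < lamE)
    {Ω : Type*} [MeasurableSpace Ω] (P : MeasureTheory.Measure Ω)
    [MeasureTheory.IsProbabilityMeasure P]
    (N : RCGossip.Clocks n lamS lamE P) (i : Fin n) :
    (∀ T : ℝ, 0 < T →
      MeasureTheory.Integrable (fun z : Ω × ℝ => N.freshness i z.2 z.1)
        (P.prod (MeasureTheory.volume.restrict (Set.Ioc 0 T)))) ∧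
    N.averageFreshness i =
      lamS / (n * lamE) * (1 - (lamS / (lamS + lamE)) ^ n) :=
  ⟨fun T _ => N.integrable_freshness hS hE i T, N.averageFreshness_eq hS hE i⟩
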